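/- Call two three-qubit vectors $\psi,\psi'\in(\mathbb C^2)^{\otimes 3}$ LU (resp. SLOCC) equivalent if $\psi'=(\mathcal A\otimes\mathcal B\otimes\mathcal C)\psi$ for some unitary (resp. invertible) $2\times 2$ matrices $\mathcal A,\mathcal B,\mathcal C$. The W class is the set of unit vectors that are SLOCC equivalent to $\frac1{\sqrt3}(|001\rangle+|010\rangle+|100\rangle)$. A W-type ASD (Schmidt decomposition of Acín et al.) is a vector $$\lambda_0|000\rangle+\lambda_1e^{i\varphi}|100\rangle+\lambda_2|101\rangle+\lambda_3|110\rangle,\qquad \lambda_i\ge 0,\ \sum_{i=0}^3\lambda_i^2=1,\ \lambda_0\lambda_2\lambda_3\ne0,\ \varphi\in[0,2\pi),$$ and it is an ASD of each vector that is LU equivalent to it. Every W-type ASD lies in the W class and every vector of the W class has a W-type ASD. The W-type ASDs are partitioned into the following eight families, all nonempty. If $\lambda_1=0$, there are three families: (1) $\lambda_0=\lambda_2=\lambda_3$; (2) $\lambda_i=\lambda_j\ne\lambda_k$ for some $(i,j,k)\in\{(0,2,3),(0,3,2),(2,3,0)\}$; (3) $\lambda_0,\lambda_2,\lambda_3$ pairwise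 distinct. If $\lambda_0\lambda_1\lambda_2\lambda_3\ne0$, there are five families: (4) $\lambda_0=\lambda_1=\lambda_2=\lambda_3$; (5) $\lambda_i=\lambda_j=\lambda_k\ne\lambda_l$ for some $(i,j,k,l)\in\{(0,1,2,3),(0,1,3,2),(0,2,3,1),(1,2,3,0)\}$; (6) $\lambda_i=\lambda_j$ and $\lambda_i\ne\lambda_k\ne\lambda_l\ne\lambda_i$ for some $(i,j,k,l)\in\{(0,1,2,3),(2,3,0,1),(0,2,1,3),(1,3,0,2),(0,3,1,2),(1,2,0,3)\}$; (7) $\lambda_i=\lambda_j\ne\lambda_k=\lambda_l$ for some $(i,j,k,l)\in\{(0,1,2,3),(0,2,1,3),(0,3,1,2)\}$; (8) $\lambda_0,\lambda_1,\lambda_2,\lambda_3$ pairwise distinct. Assigning to each vector of the W class the family of any of its ASDs is well defined (independent of the ASD chosen), and it partitions the W class into eight nonempty families, each closed under LU equivalence. -/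

import Mathlib

open scoped Kronecker

noncomputable section

/-- Vectors of three qubits A, B, C; `ψ (i, j, k)` is the coefficient of `|ijk⟩`. -/
abbrev ThreeQubit : Type := Fin 2 × Fin 2 × Fin 2 → ℂ

/-- The computational basis vector `|ijk⟩`. -/
def ket (i j k : Fin 2) : ThreeQubit := Pi.single (i, j, k) 1

/-- Unit vectors for the Euclidean (Hilbert space) norm. -/
def IsNormalized (ψ : ThreeQubit) : Prop := ∑ x, ‖ψ x‖ ^ 2 = 1

/-- Equivalence under local invertible operators: `ψ' = (A ⊗ B ⊗ C) ψ`. -/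
def SLOCCEquiv (ψ ψ' : ThreeQubit) : Prop :=
  ∃ A B C : Matrix.GeneralLinearGroup (Fin 2) ℂ,
    ψ' = ((A : Matrix (Fin 2) (Fin 2) ℂ) ⊗ₖ
      ((B : Matrix (Fin 2) (Fin 2) ℂ) ⊗ₖ (C : Matrix (Fin 2) (Fin 2) ℂ))).mulVec ψ

/-- Equivalence under local unitary operators: `ψ' = (A ⊗ B ⊗ C) ψ`. -/
def LUEquiv (ψ ψ' : ThreeQubit) : Prop :=
  ∃ A B C : Matrix.unitaryGroup (Fin 2) ℂ,
    ψ' = ((A : Matrix (Fin 2) (Fin 2) ℂ) ⊗ₖ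
      ((B : Matrix (Fin 2) (Fin 2) ℂ) ⊗ₖ (C : Matrix (Fin 2) (Fin 2) ℂ))).mulVec ψ

/-- The state W, `(|001⟩ + |010⟩ + |100⟩) / √3`. -/
def wState : ThreeQubit :=
  ((1 / Real.sqrt 3 : ℝ) : ℂ) • (ket 0 0 1 + ket 0 1 0 + ket 1 0 0)

/-- The (normalized) pure states of the W SLOCC class. -/
def wClass : Set ThreeQubit := {ψ | IsNormalized ψ ∧ SLOCCEquiv wState ψ}

/-- The vector `c₀|000⟩ + c₁ e^{iφ}|100⟩ + c₂|101⟩ + c₃|110⟩`. -/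
def asdState (c : Fin 4 → ℝ) (φ : ℝ) : ThreeQubit :=
  (c 0 : ℂ) • ket 0 0 0 + ((c 1 : ℂ) * Complex.exp (Complex.I * (φ : ℂ))) • ket 1 0 0
    + (c 2 : ℂ) • ket 1 0 1 + (c 3 : ℂ) • ket 1 1 0

/-- The admissible coefficients and phases of a Schmidt decomposition of W type. -/
structure IsWASDData (c : Fin 4 → ℝ) (φ : ℝ) : Prop where
  nonneg : ∀ i, 0 ≤ c i
  sum_sq : ∑ i, c i ^ 2 = 1
  ne_zero : c 0 * c 2 * c 3 ≠ 0
  phase : φ ∈ Set.Ico 0 (2 * Real.pi)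

/-- The Schmidt decompositions (ASDs) of W type. -/
def wASDs : Set ThreeQubit := {ψ | ∃ c φ, IsWASDData c φ ∧ ψ = asdState c φ}

/-- `(c, φ)` is an ASD of the state `ψ`. -/
def IsWASDOf (ψ : ThreeQubit) (c : Fin 4 → ℝ) (φ : ℝ) : Prop :=
  IsWASDData c φ ∧ LUEquiv ψ (asdState c φ)

/-- The eight equality patterns of the coefficients; the index `n : Fin 8` stands for
family number `n + 1`. The first three have `c₁ = 0`, the other five `c₁ ≠ 0`. -/
def EqualityPattern (n : Fin 8) (c : Fin 4 → ℝ) : Prop :=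
  match n with
  | 0 => c 1 = 0 ∧ c 0 = c 2 ∧ c 2 = c 3
  | 1 => c 1 = 0 ∧ ∃ t ∈ ({(0, 2, 3), (0, 3, 2), (2, 3, 0)} : Set (Fin 4 × Fin 4 × Fin 4)),
      c t.1 = c t.2.1 ∧ c t.2.1 ≠ c t.2.2
  | 2 => c 1 = 0 ∧ c 0 ≠ c 2 ∧ c 0 ≠ c 3 ∧ c 2 ≠ c 3
  | 3 => c 1 ≠ 0 ∧ c 0 = c 1 ∧ c 1 = c 2 ∧ c 2 = c 3
  | 4 => c 1 ≠ 0 ∧ ∃ t ∈ ({(0, 1, 2, 3), (0, 1, 3, 2), (0, 2, 3, 1), (1, 2, 3, 0)} :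
        Set (Fin 4 × Fin 4 × Fin 4 × Fin 4)),
      c t.1 = c t.2.1 ∧ c t.2.1 = c t.2.2.1 ∧ c t.2.2.1 ≠ c t.2.2.2
  | 5 => c 1 ≠ 0 ∧ ∃ t ∈ ({(0, 1, 2, 3), (2, 3, 0, 1), (0, 2, 1, 3), (1, 3, 0, 2),
        (0, 3, 1, 2), (1, 2, 0, 3)} : Set (Fin 4 × Fin 4 × Fin 4 × Fin 4)),
      c t.1 = c t.2.1 ∧ c t.1 ≠ c t.2.2.1 ∧ c t.2.2.1 ≠ c t.2.2.2 ∧ c t.2.2.2 ≠ c t.1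
  | 6 => c 1 ≠ 0 ∧ ∃ t ∈ ({(0, 1, 2, 3), (0, 2, 1, 3), (0, 3, 1, 2)} :
        Set (Fin 4 × Fin 4 × Fin 4 × Fin 4)),
      c t.1 = c t.2.1 ∧ c t.2.1 ≠ c t.2.2.1 ∧ c t.2.2.1 = c t.2.2.2
  | 7 => c 1 ≠ 0 ∧ ∀ i j, i ≠ j → c i ≠ c j

/-- The ASDs of W type whose coefficients have the `n`-th equality pattern. -/
def asdFamily (n : Fin 8) : Set ThreeQubit :=
  {ψ | ∃ c φ, IsWASDData c φ ∧ EqualityPattern n c ∧ ψ = asdState c φ}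

/-- The states of the W SLOCC class having an ASD with the `n`-th equality pattern. -/
def luFamily (n : Fin 8) : Set ThreeQubit :=
  {ψ | ψ ∈ wClass ∧ ∃ c φ, IsWASDOf ψ c φ ∧ EqualityPattern n c}

end

open Matrix

/-! The coefficients of an ASD are LU invariants, so any classification by their equalities descends
to LU classes. The determinants of the three one-qubit reduced density matrices are LU invariant; on
an ASD they are the sums of two of the three pairwise products of `c 0 ^ 2`, `c 2 ^ 2`, `c 3 ^ 2`.
These products determine the positive numbers `c 0`, `c 2`, `c 3`, and normalization then gives `c
1` (`coeff_eq_of_luEquiv`).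

An ASD exists because unitaries reduce the local operators producing a W-class vector to upper
triangular form (`exists_unitary_mul_eq_upperTriangular`). Triangular factors keep W in the span of
|000⟩, |001⟩, |010⟩, |100⟩, and flipping qubit A gives the ASD shape. It remains that each
coefficient vector has exactly one equality pattern. -/

theorem sloccEquiv_trans {ψ χ ω : ThreeQubit} (h : SLOCCEquiv ψ χ) (h' : SLOCCEquiv χ ω) :
    SLOCCEquiv ψ ω := by
  obtain ⟨A, B, C, rfl⟩ := h
  obtain ⟨A', B', C', rfl⟩ := h'
  refine ⟨A' * A, B' * B, C' * C, ?_⟩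
  simp [Matrix.mulVec_mulVec, Matrix.mul_kronecker_mul]

theorem luEquiv_refl (ψ : ThreeQubit) : LUEquiv ψ ψ := ⟨1, 1, 1, by simp⟩

theorem luEquiv_trans {ψ χ ω : ThreeQubit} (h : LUEquiv ψ χ) (h' : LUEquiv χ ω) :
    LUEquiv ψ ω := by
  obtain ⟨A, B, C, rfl⟩ := h
  obtain ⟨A', B', C', rfl⟩ := h'
  refine ⟨A' * A, B' * B, C' * C, ?_⟩
  simp [Matrix.mulVec_mulVec, Matrix.mul_kronecker_mul]

theorem luEquiv_symm {ψ χ : ThreeQubit} (h : LUEquiv ψ χ) : LUEquiv χ ψ := by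
  obtain ⟨A, B, C, rfl⟩ := h
  refine ⟨A⁻¹, B⁻¹, C⁻¹, ?_⟩
  simp only [Matrix.mulVec_mulVec, ← Matrix.mul_kronecker_mul, ← Submonoid.coe_mul,
    inv_mul_cancel]
  simp

theorem LUEquiv.sloccEquiv {ψ χ : ThreeQubit} (h : LUEquiv ψ χ) : SLOCCEquiv ψ χ := by
  obtain ⟨A, B, C, rfl⟩ := h
  exact ⟨Unitary.toUnits A, Unitary.toUnits B, Unitary.toUnits C, rfl⟩

theorem isNormalized_iff_dotProduct (ψ : ThreeQubit) :
    IsNormalized ψ ↔ star ψ ⬝ᵥ ψ = 1 := by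
  have : star ψ ⬝ᵥ ψ = ((∑ x, ‖ψ x‖ ^ 2 : ℝ) : ℂ) := by
    simp [dotProduct, Complex.conj_mul']
  rw [this, IsNormalized]
  norm_cast

theorem LUEquiv.isNormalized {ψ χ : ThreeQubit} (h : LUEquiv ψ χ) (hψ : IsNormalized ψ) :
    IsNormalized χ := by
  obtain ⟨A, B, C, rfl⟩ := h
  rw [isNormalized_iff_dotProduct] at *
  have hU := Matrix.mem_unitaryGroup_iff'.1
    (Matrix.kronecker_mem_unitary A.2 (Matrix.kronecker_mem_unitary B.2 C.2))
  rw [Matrix.star_mulVec, Matrix.dotProduct_mulVec, Matrix.vecMul_vecMul]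
  rw [Matrix.star_eq_conjTranspose] at hU
  rw [hU, Matrix.vecMul_one, hψ]

theorem LUEquiv.mem_wClass {ψ χ : ThreeQubit} (h : LUEquiv ψ χ) (hψ : ψ ∈ wClass) : χ ∈ wClass :=
  ⟨h.isNormalized hψ.1, sloccEquiv_trans hψ.2 h.sloccEquiv⟩

/-! ### LU invariants: determinants of reduced density matrices -/

/-- The matrix of a three-qubit vector with respect to the bipartition `A | BC`. -/
def flattening (ψ : ThreeQubit) : Matrix (Fin 2) (Fin 2 × Fin 2) ℂ := Matrix.of fun i x => ψ (i, x)

/-- The determinant of the reduced density matrix of the first qubit. -/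
def reducedDet (ψ : ThreeQubit) : ℂ := (flattening ψ * (flattening ψ)ᴴ).det

/-- Cyclic permutation of the three qubits. -/
def rotate (ψ : ThreeQubit) : ThreeQubit := fun x => ψ (x.2.2, x.1, x.2.1)

theorem flattening_kronecker_mulVec (A : Matrix (Fin 2) (Fin 2) ℂ)
    (K : Matrix (Fin 2 × Fin 2) (Fin 2 × Fin 2) ℂ) (ψ : ThreeQubit) :
    flattening ((A ⊗ₖ K).mulVec ψ) = A * flattening ψ * Kᵀ := by
  ext i x
  simp only [flattening, Matrix.of_apply, Matrix.mulVec, dotProduct, Matrix.mul_apply,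
    Matrix.kroneckerMap_apply, Fintype.sum_prod_type, Fin.sum_univ_two, Matrix.transpose_apply]
  ring

/-- The unitary on BC cancels in the product with the adjoint, and the one on A only conjugates it.
-/
theorem LUEquiv.reducedDet_eq {ψ χ : ThreeQubit} (h : LUEquiv ψ χ) :
    reducedDet χ = reducedDet ψ := by
  obtain ⟨A, B, C, rfl⟩ := h
  have hK := Matrix.mem_unitaryGroup_iff'.1 (Matrix.kronecker_mem_unitary B.2 C.2)
  set K := (B : Matrix (Fin 2) (Fin 2) ℂ) ⊗ₖ (C : Matrix (Fin 2) (Fin 2) ℂ)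
  have hK' : Kᵀ * Kᵀᴴ = 1 := by
    have : Kᵀᴴ = Kᴴᵀ := rfl
    rw [this, ← Matrix.transpose_mul, ← Matrix.star_eq_conjTranspose, hK, Matrix.transpose_one]
  have hA := congrArg Matrix.det (Matrix.mem_unitaryGroup_iff.1 A.2)
  rw [Matrix.det_mul, Matrix.det_one, Matrix.star_eq_conjTranspose] at hA
  have : flattening (((A : Matrix (Fin 2) (Fin 2) ℂ) ⊗ₖ K).mulVec ψ) *
      (flattening (((A : Matrix (Fin 2) (Fin 2) ℂ) ⊗ₖ K).mulVec ψ))ᴴ =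
      (A : Matrix (Fin 2) (Fin 2) ℂ) * (flattening ψ * (flattening ψ)ᴴ) * (A : Matrix (Fin 2) (Fin 2) ℂ)ᴴ := by
    rw [flattening_kronecker_mulVec]
    simp only [Matrix.conjTranspose_mul, Matrix.mul_assoc]
    rw [← Matrix.mul_assoc Kᵀ, hK', Matrix.one_mul]
  rw [reducedDet, this, Matrix.det_mul, Matrix.det_mul, reducedDet, mul_right_comm, hA, one_mul]

/-- This carries the invariance for qubit A over to qubits B and C. -/
theorem LUEquiv.rotate {ψ χ : ThreeQubit} (h : LUEquiv ψ χ) :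
    LUEquiv (rotate ψ) (rotate χ) := by
  obtain ⟨A, B, C, rfl⟩ := h
  refine ⟨B, C, A, ?_⟩
  ext ⟨i, j, k⟩
  simp only [_root_.rotate, Matrix.mulVec, dotProduct, Matrix.kroneckerMap_apply,
    Fintype.sum_prod_type, Fin.sum_univ_two]
  ring

theorem reducedDet_asdState (c : Fin 4 → ℝ) (φ : ℝ) :
    reducedDet (asdState c φ) = ((c 0 ^ 2 * (c 2 ^ 2 + c 3 ^ 2) : ℝ) : ℂ) := by
  simp [reducedDet, flattening, asdState, ket, Matrix.det_fin_two, Matrix.mul_apply,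
    Fintype.sum_prod_type, Fin.sum_univ_two, Pi.single_apply]
  ring

theorem reducedDet_rotate_asdState (c : Fin 4 → ℝ) (φ : ℝ) :
    reducedDet (rotate (asdState c φ)) = ((c 3 ^ 2 * (c 0 ^ 2 + c 2 ^ 2) : ℝ) : ℂ) := by
  simp [reducedDet, flattening, asdState, ket, Matrix.det_fin_two, Matrix.mul_apply, rotate,
    Fintype.sum_prod_type, Fin.sum_univ_two, Pi.single_apply]
  ring

theorem reducedDet_rotate_rotate_asdState (c : Fin 4 → ℝ) (φ : ℝ) :
    reducedDet (rotate (rotate (asdState c φ))) =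
      ((c 2 ^ 2 * (c 0 ^ 2 + c 3 ^ 2) : ℝ) : ℂ) := by
  simp [reducedDet, flattening, asdState, ket, Matrix.det_fin_two, Matrix.mul_apply, rotate,
    Fintype.sum_prod_type, Fin.sum_univ_two, Pi.single_apply]
  ring

/-- `x ^ 2` is the quotient of `(x * y) * (x * z)` by `y * z`. -/
theorem eq_of_mul_eq_mul_of_pos {x y z x' y' z' : ℝ} (hx : 0 < x) (hy : 0 < y) (hz : 0 < z)
    (hx' : 0 < x') (hxy : x * y = x' * y') (hxz : x * z = x' * z') (hyz : y * z = y' * z') : x = x' := by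
  have h : x ^ 2 * (y * z) = x' ^ 2 * (y * z) := by
    calc x ^ 2 * (y * z) = (x * y) * (x * z) := by ring
      _ = x' ^ 2 * (y' * z') := by rw [hxy, hxz]; ring
      _ = x' ^ 2 * (y * z) := by rw [hyz]
  exact (pow_left_inj₀ hx.le hx'.le two_ne_zero).1 (mul_right_cancel₀ (mul_pos hy hz).ne' h)

theorem IsWASDData.pos {c : Fin 4 → ℝ} {φ : ℝ} (h : IsWASDData c φ) :
    0 < c 0 ∧ 0 < c 2 ∧ 0 < c 3 := by
  have h0 := h.ne_zero
  simp only [ne_eq, mul_eq_zero, not_or] at h0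
  exact ⟨(h.nonneg 0).lt_of_ne' h0.1.1, (h.nonneg 2).lt_of_ne' h0.1.2, (h.nonneg 3).lt_of_ne' h0.2⟩

/-- The coefficients of a W-type Schmidt decomposition are determined by its LU class. -/
theorem coeff_eq_of_luEquiv {c c' : Fin 4 → ℝ} {φ φ' : ℝ} (h : IsWASDData c φ)
    (h' : IsWASDData c' φ') (hlu : LUEquiv (asdState c φ) (asdState c' φ')) : c = c' := by
  obtain ⟨p0, p2, p3⟩ := h.pos
  obtain ⟨q0, q2, q3⟩ := h'.pos
  have e1 := hlu.reducedDet_eq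
  have e2 := hlu.rotate.reducedDet_eq
  have e3 := hlu.rotate.rotate.reducedDet_eq
  rw [reducedDet_asdState, reducedDet_asdState, Complex.ofReal_inj] at e1
  rw [reducedDet_rotate_asdState, reducedDet_rotate_asdState, Complex.ofReal_inj] at e2
  rw [reducedDet_rotate_rotate_asdState, reducedDet_rotate_rotate_asdState,
    Complex.ofReal_inj] at e3
  -- Each product is half of the sum of two determinants minus the third.
  have h02 : c 0 ^ 2 * c 2 ^ 2 = c' 0 ^ 2 * c' 2 ^ 2 := by linarith
  have h03 : c 0 ^ 2 * c 3 ^ 2 = c' 0 ^ 2 * c' 3 ^ 2 := by linarith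
  have h23 : c 2 ^ 2 * c 3 ^ 2 = c' 2 ^ 2 * c' 3 ^ 2 := by linarith
  have s0 : c 0 ^ 2 = c' 0 ^ 2 := eq_of_mul_eq_mul_of_pos (pow_pos p0 2) (pow_pos p2 2)
    (pow_pos p3 2) (pow_pos q0 2) h02 h03 h23
  have s2 : c 2 ^ 2 = c' 2 ^ 2 := by
    rw [s0] at h02
    exact mul_left_cancel₀ (pow_pos q0 2).ne' h02
  have s3 : c 3 ^ 2 = c' 3 ^ 2 := by
    rw [s0] at h03
    exact mul_left_cancel₀ (pow_pos q0 2).ne' h03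
  have s1 : c 1 ^ 2 = c' 1 ^ 2 := by
    have t := h.sum_sq
    have t' := h'.sum_sq
    rw [Fin.sum_univ_four] at t t'
    linarith
  funext i
  refine (pow_left_inj₀ (h.nonneg i) (h'.nonneg i) two_ne_zero).1 ?_
  fin_cases i
  exacts [s0, s1, s2, s3]

/-! ### Every W-type ASD lies in the W class -/

theorem isNormalized_asdState_iff (c : Fin 4 → ℝ) (φ : ℝ) :
    IsNormalized (asdState c φ) ↔ ∑ i, c i ^ 2 = 1 := by
  have hφ : ‖Complex.exp (Complex.I * (φ : ℂ))‖ = 1 := by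
    rw [mul_comm, Complex.norm_exp_ofReal_mul_I]
  have : ∑ x, ‖asdState c φ x‖ ^ 2 = ∑ i, c i ^ 2 := by
    simp [asdState, ket, Fintype.sum_prod_type, Fin.sum_univ_two, Pi.single_apply,
      Fin.sum_univ_four, hφ]
    ring
  rw [IsNormalized, this]

theorem wASDs_subset_wClass : wASDs ⊆ wClass := by
  rintro ψ ⟨c, φ, h, rfl⟩
  refine ⟨(isNormalized_asdState_iff c φ).2 h.sum_sq, ?_⟩
  obtain ⟨p0, p2, p3⟩ := h.pos
  have hs : ((Real.sqrt 3 : ℝ) : ℂ) ≠ 0 := by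
    exact_mod_cast (Real.sqrt_pos.2 (by norm_num : (0 : ℝ) < 3)).ne'
  have h0 : (c 0 : ℂ) ≠ 0 := by exact_mod_cast p0.ne'
  have h2 : (c 2 : ℂ) ≠ 0 := by exact_mod_cast p2.ne'
  have h3 : (c 3 : ℂ) ≠ 0 := by exact_mod_cast p3.ne'
  set s : ℂ := ((Real.sqrt 3 : ℝ) : ℂ) with hs_def
  -- The first operator sends |0⟩ to |1⟩ and |1⟩ to `s` times the qubit-A factor paired with |00⟩;
  -- the others rescale |1⟩. The factors `s` cancel the normalization of W.
  refine ⟨Matrix.GeneralLinearGroup.mkOfDetNeZero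
      !![0, s * c 0; 1, s * (c 1 * Complex.exp (Complex.I * (φ : ℂ)))] ?_,
    Matrix.GeneralLinearGroup.mkOfDetNeZero !![1, 0; 0, s * c 3] ?_,
    Matrix.GeneralLinearGroup.mkOfDetNeZero !![1, 0; 0, s * c 2] ?_, ?_⟩
  · simp [Matrix.det_fin_two, hs, h0]
  · simp [Matrix.det_fin_two, hs, h3]
  · simp [Matrix.det_fin_two, hs, h2]
  · ext ⟨i, j, k⟩
    fin_cases i <;> fin_cases j <;> fin_cases k <;>
      simp [asdState, wState, ket, Matrix.mulVec, dotProduct, Fintype.sum_prod_type,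
        Fin.sum_univ_two, Pi.single_apply, Matrix.GeneralLinearGroup.mkOfDetNeZero, ← hs_def] <;>
      field_simp

/-! ### Existence of an ASD -/

/-- `QR` decomposition of an invertible `2 × 2` matrix with positive diagonal in `R`. -/
theorem exists_unitary_mul_eq_upperTriangular (M : Matrix (Fin 2) (Fin 2) ℂ) (hM : M.det ≠ 0) :
    ∃ U : Matrix.unitaryGroup (Fin 2) ℂ, ∃ (p q : ℝ) (z : ℂ), 0 < p ∧ 0 < q ∧
      (U : Matrix (Fin 2) (Fin 2) ℂ) * M = !![(p : ℂ), z; 0, (q : ℂ)] := by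
  obtain ⟨a, x, b, y, rfl⟩ : ∃ a x b y, M = !![a, x; b, y] := ⟨_, _, _, _, Matrix.eta_fin_two M⟩
  rw [Matrix.det_fin_two_of] at hM
  obtain ⟨d, hdet⟩ : ∃ d, a * y - x * b = d := ⟨_, rfl⟩
  rw [hdet] at hM
  have hpos : 0 < ‖a‖ ^ 2 + ‖b‖ ^ 2 := by
    by_contra hle
    have ha : ‖a‖ = 0 := by nlinarith [sq_nonneg ‖a‖, sq_nonneg ‖b‖]
    have hb : ‖b‖ = 0 := by nlinarith [sq_nonneg ‖a‖, sq_nonneg ‖b‖]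
    rw [norm_eq_zero] at ha hb
    apply hM
    rw [← hdet, ha, hb]
    ring
  obtain ⟨n, hn_def⟩ : ∃ n, n = Real.sqrt (‖a‖ ^ 2 + ‖b‖ ^ 2) := ⟨_, rfl⟩
  have hn : 0 < n := hn_def ▸ Real.sqrt_pos.2 hpos
  have hn0 : (n : ℂ) ≠ 0 := by exact_mod_cast hn.ne'
  have hd : 0 < ‖d‖ := norm_pos_iff.2 hM
  have hd0 : (‖d‖ : ℂ) ≠ 0 := by exact_mod_cast hd.ne'
  have hn2 : starRingEnd ℂ a * a + starRingEnd ℂ b * b = (n : ℂ) ^ 2 := by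
    have : n ^ 2 = ‖a‖ ^ 2 + ‖b‖ ^ 2 := hn_def ▸ Real.sq_sqrt hpos.le
    rw [Complex.conj_mul', Complex.conj_mul']
    exact_mod_cast this.symm
  have hd2 : starRingEnd ℂ d * d = (‖d‖ : ℂ) ^ 2 := Complex.conj_mul' d
  -- The first row is the normalized adjoint of the first column of the matrix; the second
  -- annihilates that column, its phase chosen to make the last diagonal entry `‖d‖ / n`.
  let V : Matrix (Fin 2) (Fin 2) ℂ :=
    !![starRingEnd ℂ a / n, starRingEnd ℂ b / n;
      -b / n * (starRingEnd ℂ d / ‖d‖), a / n * (starRingEnd ℂ d / ‖d‖)]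
  have hV : V ∈ Matrix.unitaryGroup (Fin 2) ℂ := by
    rw [Matrix.mem_unitaryGroup_iff]
    ext i j
    fin_cases i <;> fin_cases j <;>
      simp [V, Matrix.mul_apply, Fin.sum_univ_two, Matrix.star_apply] <;> field_simp
    · linear_combination hn2
    · ring
    · ring
    · linear_combination starRingEnd ℂ d * d * hn2 + (n : ℂ) ^ 2 * hd2
  refine ⟨⟨V, hV⟩, n, ‖d‖ / n, (starRingEnd ℂ a * x + starRingEnd ℂ b * y) / n, hn,
    by positivity, ?_⟩
  ext i j
  fin_cases i <;> fin_cases j <;> simp [V, Matrix.mul_apply, Fin.sum_univ_two] <;> field_simp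
  · linear_combination hn2
  · ring
  · linear_combination hd2 + starRingEnd ℂ d * hdet

theorem exists_isWASDOf {ψ : ThreeQubit} (hψ : ψ ∈ wClass) : ∃ c φ, IsWASDOf ψ c φ := by
  obtain ⟨hnorm, A, B, C, rfl⟩ := hψ
  have hdet (G : Matrix.GeneralLinearGroup (Fin 2) ℂ) :
      (G : Matrix (Fin 2) (Fin 2) ℂ).det ≠ 0 := G.det_ne_zero
  obtain ⟨U, a, x, y, ha, hx, hU⟩ := exists_unitary_mul_eq_upperTriangular _ (hdet A)
  obtain ⟨V, b, b', v, hb, hb', hV⟩ := exists_unitary_mul_eq_upperTriangular _ (hdet B)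
  obtain ⟨W, c, c', w, hc, hc', hW⟩ := exists_unitary_mul_eq_upperTriangular _ (hdet C)
  have hS : !![(0 : ℂ), 1; 1, 0] ∈ Matrix.unitaryGroup (Fin 2) ℂ := by
    rw [Matrix.mem_unitaryGroup_iff]
    ext i j
    fin_cases i <;> fin_cases j <;> simp [Matrix.mul_apply, Fin.sum_univ_two]
  set s := Real.sqrt 3
  have hs : 0 < s := Real.sqrt_pos.2 (by norm_num)
  -- The coefficient of |000⟩ before the flip of qubit A, of |100⟩ after it. The other three are
  -- positive since the triangular factors have positive diagonals, so only `m` carries a phase.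
  let m : ℂ := (a * (b * w + v * c) + y * b * c) / s
  let k : Fin 4 → ℝ := ![x * b * c / s, ‖m‖, a * b * c' / s, a * b' * c / s]
  let φ := toIcoMod Real.two_pi_pos 0 m.arg
  have hm : (‖m‖ : ℂ) * Complex.exp (Complex.I * (φ : ℂ)) = m := by
    have : Complex.exp (Complex.I * (φ : ℂ)) = Complex.exp (m.arg * Complex.I) := by
      rw [mul_comm, Complex.exp_eq_exp_iff_exists_int]
      refine ⟨-toIcoDiv Real.two_pi_pos 0 m.arg, ?_⟩
      have := self_sub_toIcoDiv_zsmul Real.two_pi_pos 0 m.arg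
      change ((toIcoMod Real.two_pi_pos 0 m.arg : ℝ) : ℂ) * _ = _
      rw [← this]
      push_cast [zsmul_eq_mul]
      ring
    rw [this, Complex.norm_mul_exp_arg_mul_I]
  have hlu : LUEquiv (((A : Matrix (Fin 2) (Fin 2) ℂ) ⊗ₖ
      ((B : Matrix (Fin 2) (Fin 2) ℂ) ⊗ₖ (C : Matrix (Fin 2) (Fin 2) ℂ))).mulVec wState)
      (asdState k φ) := by
    refine ⟨⟨_, hS⟩ * U, V, W, ?_⟩
    rw [Matrix.mulVec_mulVec, ← Matrix.mul_kronecker_mul, ← Matrix.mul_kronecker_mul,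
      Submonoid.coe_mul, Matrix.mul_assoc, hU, hV, hW]
    have hs0 : (s : ℂ) ≠ 0 := by exact_mod_cast hs.ne'
    have hk1 : (k 1 : ℂ) * Complex.exp (Complex.I * (φ : ℂ)) = m := hm
    rw [asdState, hk1]
    ext ⟨i, j, l⟩
    fin_cases i <;> fin_cases j <;> fin_cases l <;>
      simp [wState, ket, Matrix.mulVec, dotProduct, Fintype.sum_prod_type,
        Fin.sum_univ_two, Pi.single_apply, k, m] <;> field_simp <;> ring
  refine ⟨k, φ, ⟨?_, ?_, ?_, ?_⟩, hlu⟩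
  · intro i
    fin_cases i <;> simp [k] <;> positivity
  · exact (isNormalized_asdState_iff k φ).1 (hlu.isNormalized hnorm)
  · have : 0 < k 0 * k 2 * k 3 := by
      simp only [k, Matrix.cons_val]
      positivity
    exact this.ne'
  · simpa using toIcoMod_mem_Ico Real.two_pi_pos 0 m.arg

/-! ### Each coefficient vector has exactly one equality pattern -/

theorem EqualityPattern.unique {m n : Fin 8} {c : Fin 4 → ℝ} (hm : EqualityPattern m c)
    (hn : EqualityPattern n c) : m = n := by
  fin_cases m <;> fin_cases n <;> first
    | rfl
    | exfalso
      simp [EqualityPattern, Fin.forall_fin_succ] at hm hn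
      grind

theorem exists_equalityPattern_of_eq_zero {c : Fin 4 → ℝ} (h : c 1 = 0) :
    ∃ n ∈ ({0, 1, 2} : Set (Fin 8)), EqualityPattern n c := by
  simp [EqualityPattern]
  grind

theorem exists_equalityPattern_of_ne_zero {c : Fin 4 → ℝ} (h : c 1 ≠ 0) :
    ∃ n ∈ ({3, 4, 5, 6, 7} : Set (Fin 8)), EqualityPattern n c := by
  simp [EqualityPattern, Fin.forall_fin_succ]
  by_cases h01 : c 0 = c 1 <;> by_cases h02 : c 0 = c 2 <;> by_cases h03 : c 0 = c 3 <;>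
    by_cases h12 : c 1 = c 2 <;> by_cases h13 : c 1 = c 3 <;> by_cases h23 : c 2 = c 3 <;> grind

theorem exists_equalityPattern (c : Fin 4 → ℝ) : ∃ n, EqualityPattern n c := by
  by_cases h : c 1 = 0
  · exact (exists_equalityPattern_of_eq_zero h).imp fun _ => And.right
  · exact (exists_equalityPattern_of_ne_zero h).imp fun _ => And.right

theorem EqualityPattern.eq_zero_of_mem {n : Fin 8} {c : Fin 4 → ℝ} (h : EqualityPattern n c)
    (hn : n ∈ ({0, 1, 2} : Set (Fin 8))) : c 1 = 0 := by
  rcases hn with rfl | rfl | rfl <;> exact h.1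

theorem EqualityPattern.ne_zero_of_mem {n : Fin 8} {c : Fin 4 → ℝ} (h : EqualityPattern n c)
    (hn : n ∈ ({3, 4, 5, 6, 7} : Set (Fin 8))) : c 1 ≠ 0 := by
  rcases hn with rfl | rfl | rfl | rfl | rfl <;> exact h.1

/-- Patterns are scale invariant, so witnesses for nonemptiness can be integer vectors, normalized
afterwards. -/
theorem EqualityPattern.const_mul {n : Fin 8} {c : Fin 4 → ℝ} (h : EqualityPattern n c) {r : ℝ}
    (hr : r ≠ 0) : EqualityPattern n fun i => r * c i := by
  fin_cases n <;> simpa [EqualityPattern, hr] using h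

theorem asdFamily_nonempty_of_pattern {n : Fin 8} {c : Fin 4 → ℝ} (h : EqualityPattern n c)
    (hc : ∀ i, 0 ≤ c i) (h0 : 0 < c 0) (h2 : 0 < c 2) (h3 : 0 < c 3) :
    (asdFamily n).Nonempty := by
  have hS : 0 < ∑ i, c i ^ 2 :=
    Finset.sum_pos' (fun i _ => sq_nonneg _) ⟨0, Finset.mem_univ _, by positivity⟩
  have hr : 0 < (Real.sqrt (∑ i, c i ^ 2))⁻¹ := inv_pos.2 (Real.sqrt_pos.2 hS)
  refine ⟨_, _, 0, ⟨fun i => mul_nonneg hr.le (hc i), ?_, ?_, ?_⟩, h.const_mul hr.ne', rfl⟩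
  · simp only [mul_pow, inv_pow, ← Finset.mul_sum, Real.sq_sqrt hS.le]
    exact inv_mul_cancel₀ hS.ne'
  · positivity
  · simp [Real.pi_pos]

theorem asdFamily_nonempty (n : Fin 8) : (asdFamily n).Nonempty := by
  have key (w : Fin 4 → ℝ) (h : EqualityPattern n w) (hw : ∀ i, 0 ≤ w i) (h0 : 0 < w 0)
    (h2 : 0 < w 2) (h3 : 0 < w 3) := asdFamily_nonempty_of_pattern h hw h0 h2 h3
  fin_cases n
  · apply key ![1, 0, 1, 1] <;> simp [EqualityPattern, Fin.forall_fin_succ]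
  · apply key ![1, 0, 1, 2] <;> simp [EqualityPattern, Fin.forall_fin_succ]
  · apply key ![1, 0, 2, 3] <;> simp [EqualityPattern, Fin.forall_fin_succ]
  · apply key ![1, 1, 1, 1] <;> simp [EqualityPattern, Fin.forall_fin_succ]
  · apply key ![1, 1, 1, 2] <;> simp [EqualityPattern, Fin.forall_fin_succ]
  · apply key ![1, 1, 2, 3] <;> simp [EqualityPattern, Fin.forall_fin_succ]
  · apply key ![1, 1, 2, 2] <;> simp [EqualityPattern, Fin.forall_fin_succ]
  · apply key ![1, 2, 3, 4] <;> simp [EqualityPattern, Fin.forall_fin_succ]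

/-! ### The induced partition of the W class -/

/-- Two ASDs of the same vector are LU equivalent to each other, hence share their coefficients. -/
theorem mem_luFamily_iff {ψ : ThreeQubit} (hψ : ψ ∈ wClass) {c : Fin 4 → ℝ} {φ : ℝ}
    (h : IsWASDOf ψ c φ) (n : Fin 8) : ψ ∈ luFamily n ↔ EqualityPattern n c := by
  refine ⟨?_, fun hn => ⟨hψ, c, φ, h, hn⟩⟩
  rintro ⟨-, c', φ', h', hn⟩
  rwa [coeff_eq_of_luEquiv h.1 h'.1 (luEquiv_trans (luEquiv_symm h.2) h'.2)]

theorem mem_luFamily_of_luEquiv {n : Fin 8} {ψ χ : ThreeQubit} (hψ : ψ ∈ luFamily n)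
    (h : LUEquiv ψ χ) : χ ∈ luFamily n := by
  obtain ⟨hW, c, φ, hc, hn⟩ := hψ
  exact ⟨h.mem_wClass hW, c, φ, ⟨hc.1, luEquiv_trans (luEquiv_symm h) hc.2⟩, hn⟩

theorem asdFamily_subset_luFamily (n : Fin 8) : asdFamily n ⊆ luFamily n := by
  rintro ψ ⟨c, φ, h, hn, rfl⟩
  exact ⟨wASDs_subset_wClass ⟨c, φ, h, rfl⟩, c, φ, ⟨h, luEquiv_refl _⟩, hn⟩

theorem luFamily_disjoint {m n : Fin 8} (hmn : m ≠ n) : Disjoint (luFamily m) (luFamily n) := by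
  rw [Set.disjoint_left]
  rintro ψ ⟨hW, c, φ, h, hm⟩ hn
  exact hmn (hm.unique ((mem_luFamily_iff hW h n).1 hn))

theorem lemma2 :
    -- the ASDs of W type belong to the W class, and every state of the W class has one
    (wASDs ⊆ wClass ∧ ∀ ψ ∈ wClass, ∃ c φ, IsWASDOf ψ c φ) ∧
    -- the eight families partition the ASDs: three for `c₁ = 0`, five for `c₁ ≠ 0`
    ((∀ n, (asdFamily n).Nonempty) ∧
      (∀ m n, m ≠ n → Disjoint (asdFamily m) (asdFamily n)) ∧
      (⋃ n, asdFamily n) = wASDs ∧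
      (⋃ n ∈ ({0, 1, 2} : Set (Fin 8)), asdFamily n) =
        {ψ | ∃ c φ, IsWASDData c φ ∧ c 1 = 0 ∧ ψ = asdState c φ} ∧
      (⋃ n ∈ ({3, 4, 5, 6, 7} : Set (Fin 8)), asdFamily n) =
        {ψ | ∃ c φ, IsWASDData c φ ∧ c 0 * c 1 * c 2 * c 3 ≠ 0 ∧ ψ = asdState c φ}) ∧
    -- they induce a partition of the W class into eight LU invariant families, and the family
    -- of a state can be read off from any of its ASDs
    ((∀ n, (luFamily n).Nonempty) ∧
      (∀ m n, m ≠ n → Disjoint (luFamily m) (luFamily n)) ∧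
      (⋃ n, luFamily n) = wClass ∧
      (∀ n, ∀ ψ ∈ luFamily n, ∀ ψ', LUEquiv ψ ψ' → ψ' ∈ luFamily n) ∧
      (∀ ψ ∈ wClass, ∀ c φ, IsWASDOf ψ c φ →
        ∀ n, ψ ∈ luFamily n ↔ EqualityPattern n c)) := by
  refine ⟨⟨wASDs_subset_wClass, fun ψ => exists_isWASDOf⟩,
    -- Disjointness of the ASD families is inherited from the larger LU families.
    ⟨asdFamily_nonempty, fun m n hmn => (luFamily_disjoint hmn).mono
      (asdFamily_subset_luFamily m) (asdFamily_subset_luFamily n), ?_, ?_, ?_⟩,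
    fun n => (asdFamily_nonempty n).mono (asdFamily_subset_luFamily n),
    fun m n => luFamily_disjoint, ?_, fun n ψ hψ ψ' => mem_luFamily_of_luEquiv hψ,
    fun ψ hψ c φ h n => mem_luFamily_iff hψ h n⟩
  · ext ψ
    simp only [Set.mem_iUnion]
    constructor
    · rintro ⟨n, c, φ, h, -, rfl⟩
      exact ⟨c, φ, h, rfl⟩
    · rintro ⟨c, φ, h, rfl⟩
      obtain ⟨n, hn⟩ := exists_equalityPattern c
      exact ⟨n, c, φ, h, hn, rfl⟩
  · ext ψ
    simp only [Set.mem_iUnion]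
    constructor
    · rintro ⟨n, hmem, c, φ, h, hn, rfl⟩
      exact ⟨c, φ, h, hn.eq_zero_of_mem hmem, rfl⟩
    · rintro ⟨c, φ, h, h1, rfl⟩
      obtain ⟨n, hmem, hn⟩ := exists_equalityPattern_of_eq_zero h1
      exact ⟨n, hmem, c, φ, h, hn, rfl⟩
  · ext ψ
    simp only [Set.mem_iUnion]
    constructor
    · rintro ⟨n, hmem, c, φ, h, hn, rfl⟩
      obtain ⟨h0, h2, h3⟩ := h.pos
      exact ⟨c, φ, h, mul_ne_zero (mul_ne_zero (mul_ne_zero h0.ne' (hn.ne_zero_of_mem hmem))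
        h2.ne') h3.ne', rfl⟩
    · rintro ⟨c, φ, h, h1, rfl⟩
      obtain ⟨n, hmem, hn⟩ := exists_equalityPattern_of_ne_zero (c := c)
        fun h0 => h1 (by simp [h0])
      exact ⟨n, hmem, c, φ, h, hn, rfl⟩
  · ext ψ
    simp only [Set.mem_iUnion]
    constructor
    · rintro ⟨n, hψ, -⟩
      exact hψ
    · intro hψ
      obtain ⟨c, φ, h⟩ := exists_isWASDOf hψ
      obtain ⟨n, hn⟩ := exists_equalityPattern c
      exact ⟨n, hψ, c, φ, h, hn⟩
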